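/- Let $(B_t)_{t\ge 0}$ be a real Brownian motion on a probability space $(\Omega,\mathcal F,P)$ whose $\sigma$-algebra $\mathcal F$ is generated by $B$ up to $P$-null sets. Let $D:\mathbb D^{1,2}\subset L^2(\Omega)\to L^2([0,\infty)\times\Omega)$ be the Malliavin derivative, i.e. the closure of the operator $$f\Big(\int_0^\infty h_1\,dB,\dots,\int_0^\infty h_n\,dB\Big)\;\longmapsto\;\sum_{i=1}^n \partial_i f\Big(\int_0^\infty h_1\,dB,\dots,\int_0^\infty h_n\,dB\Big)\,h_i(t),$$ where $n\ge 0$, $h_i\in L^2([0,\infty))$, $\int_0^\infty h_i\,dB$ are Wiener integrals, and $f\in C^\infty(\mathbb R^n)$ has, together with all its derivatives, at most polynomial growth. The Skorohod integral $\delta$ is the adjoint of $D$: a process $u\in L^2([0,\infty)\times\Omega)$ belongs to $\mathrm{Dom}\,\delta$ (is Skorohod integrable) if there is $Y\in L^2(\Omega)$ with $E[FY]=E\int_0^\infty D_tF\,u_t\,dt$ for all $F\in\mathbb D^{1,2}$, and then $\delta(u)=Y$ (unique up to almost sure equality). Theorem. Let $G\subset\mathbb R$, let $\mu$ be a $\sigma$-finite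 measure on $G$, and let $u=\{u_t(x):t\ge 0,\ x\in G\}$ be a real random field, jointly measurable in $(t,x,\omega)$, such that $u_\cdot(x)\in\mathrm{Dom}\,\delta$ for every $x\in G$. Suppose that $$\int_G\Big(E\int_0^\infty |u_t(x)|^2\,dt\Big)^{1/2}d\mu(x)<\infty\quad\text{and}\quad \int_G E\big[\delta(u_\cdot(x))^2\big]^{1/2}\,d\mu(x)<\infty.$$ Then $x\mapsto u_t(x)$ is $\mu$-integrable for almost every $(t,\omega)$, the process $\big\{\int_G u_t(x)\,d\mu(x):t\ge 0\big\}$ is Skorohod integrable, the field $(x,\omega)\mapsto\delta(u_\cdot(x))(\omega)$ has a jointly measurable version, and almost surely $$\delta\Big(\int_G u_\cdot(x)\,d\mu(x)\Big)=\int_G\delta(u_\cdot(x))\,d\mu(x),$$ where on the right any jointly measurable $(x,\omega)\mapsto Y(x,\omega)$ with $Y(x,\cdot)=\delta(u_\cdot(x))$ almost surely for $\mu$-almost every $x$ may be used, and the integral converges absolutely almost surely. -/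

import Mathlib

open MeasureTheory ProbabilityTheory Filter Topology
open scoped NNReal ENNReal

noncomputable section

namespace SkorohodCalculus

variable {Ω : Type*} [MeasurableSpace Ω]

/-- Lebesgue measure on the time axis `[0,∞)`. -/
def lebesgue : Measure ℝ≥0 := Measure.comap ((↑) : ℝ≥0 → ℝ) volume

/-- The σ-algebra of `Ω` is generated by the process `B`, up to `P`-null sets. -/
def GeneratedBy (B : ℝ≥0 → Ω → ℝ) (P : Measure Ω) : Prop :=
  ∀ s : Set Ω, MeasurableSet s →
    ∃ s' : Set Ω, MeasurableSet[⨆ t, MeasurableSpace.comap (B t) (borel ℝ)] s' ∧ s =ᵐ[P] s'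

/-- The step function `∑ₜ c(t) 1_{[0,t]}` on `[0,∞)`, for a finitely supported `c`. -/
def stepFun (c : ℝ≥0 →₀ ℝ) (s : ℝ≥0) : ℝ :=
  c.sum fun t a => a * (Set.Iic t).indicator (fun _ => (1 : ℝ)) s

/-- The integral `∑ₜ c(t) Bₜ` of the step function `∑ₜ c(t) 1_{[0,t]}` against `B`. -/
def stepIntegral (B : ℝ≥0 → Ω → ℝ) (c : ℝ≥0 →₀ ℝ) (ω : Ω) : ℝ :=
  c.sum fun t a => a * B t ω

/-- `X` is (a version of) the Wiener integral `∫₀^∞ h(s) dBₛ` of `h ∈ L²([0,∞))`: the `L²`-limit of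
the integrals of step functions that converge to `h` in `L²([0,∞))`. -/
def IsWienerIntegral (B : ℝ≥0 → Ω → ℝ) (P : Measure Ω) (h : ℝ≥0 → ℝ) (X : Ω → ℝ) : Prop :=
  MemLp h 2 lebesgue ∧ MemLp X 2 P ∧
    ∃ c : ℕ → (ℝ≥0 →₀ ℝ),
      Tendsto (fun k => eLpNorm (fun s => stepFun (c k) s - h s) 2 lebesgue) atTop (𝓝 0) ∧
      Tendsto (fun k => eLpNorm (fun ω => stepIntegral B (c k) ω - X ω) 2 P) atTop (𝓝 0)

/-- `F = f(∫ h₁ dB, …, ∫ hₙ dB)` is a smooth random variable, where `f` is `C^∞` and has, with all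
its derivatives, at most polynomial growth, and
`DF t ω = ∑ᵢ ∂ᵢf(∫ h₁ dB, …, ∫ hₙ dB) hᵢ(t)` is its derivative process. -/
def IsSmoothRV (B : ℝ≥0 → Ω → ℝ) (P : Measure Ω) (F : Ω → ℝ) (DF : ℝ≥0 → Ω → ℝ) : Prop :=
  ∃ (n : ℕ) (f : (Fin n → ℝ) → ℝ) (h : Fin n → ℝ≥0 → ℝ) (X : Fin n → Ω → ℝ),
    f.HasTemperateGrowth ∧
    (∀ i, IsWienerIntegral B P (h i) (X i)) ∧
    (∀ ω, F ω = f fun i => X i ω) ∧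
    ∀ t ω, DF t ω = ∑ i, fderiv ℝ f (fun j => X j ω) (Pi.single i 1) * h i t

/-- The graph of the Malliavin derivative `D : 𝔻^{1,2} ⊆ L²(Ω) → L²([0,∞) × Ω)`: the closure of the
graph of the derivative on smooth random variables. -/
def IsMalliavinDeriv (B : ℝ≥0 → Ω → ℝ) (P : Measure Ω) (F : Ω → ℝ) (DF : ℝ≥0 → Ω → ℝ) : Prop :=
  MemLp F 2 P ∧ MemLp (fun p : ℝ≥0 × Ω => DF p.1 p.2) 2 (lebesgue.prod P) ∧
    ∃ (G : ℕ → Ω → ℝ) (DG : ℕ → ℝ≥0 → Ω → ℝ),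
      (∀ k, IsSmoothRV B P (G k) (DG k)) ∧
      Tendsto (fun k => eLpNorm (fun ω => G k ω - F ω) 2 P) atTop (𝓝 0) ∧
      Tendsto (fun k => eLpNorm (fun p : ℝ≥0 × Ω => DG k p.1 p.2 - DF p.1 p.2) 2
        (lebesgue.prod P)) atTop (𝓝 0)

/-- The graph of the Skorohod integral `δ`, the adjoint of the Malliavin derivative:
`u ∈ L²([0,∞) × Ω)`, `Y ∈ L²(Ω)` and `E[F Y] = E[∫₀^∞ DₜF uₜ dt]` for all `F ∈ 𝔻^{1,2}`. -/
def IsSkorohodIntegral (B : ℝ≥0 → Ω → ℝ) (P : Measure Ω) (u : ℝ≥0 → Ω → ℝ) (Y : Ω → ℝ) : Prop :=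
  MemLp (fun p : ℝ≥0 × Ω => u p.1 p.2) 2 (lebesgue.prod P) ∧ MemLp Y 2 P ∧
    ∀ (F : Ω → ℝ) (DF : ℝ≥0 → Ω → ℝ), IsMalliavinDeriv B P F DF →
      ∫ ω, F ω * Y ω ∂P = ∫ ω, (∫ t, DF t ω * u t ω ∂lebesgue) ∂P

/-- `u ∈ Dom δ`. -/
def SkorohodIntegrable (B : ℝ≥0 → Ω → ℝ) (P : Measure Ω) (u : ℝ≥0 → Ω → ℝ) : Prop :=
  ∃ Y : Ω → ℝ, IsSkorohodIntegral B P u Y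

open Classical in
/-- A version of the random variable `δ(u)` for `u ∈ Dom δ` (and `0` for `u ∉ Dom δ`); when `B`
generates the σ-algebra of `Ω` up to null sets, it is unique up to almost sure equality. -/
def skorohod (B : ℝ≥0 → Ω → ℝ) (P : Measure Ω) (u : ℝ≥0 → Ω → ℝ) : Ω → ℝ :=
  if hu : SkorohodIntegrable B P u then hu.choose else 0

end SkorohodCalculus

end

namespace SkorohodCalculus

/-! The identity holds by duality. Paired with `F`, the right side becomes an `x`-integral of `E[F
δ(u(x))]`, that is, of `E∫ DₜF uₜ(x) dt`, and Fubini moves the `x`-integral back inside. Minkowski's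
inequality (`lintegral_sq_lintegral_le`) puts the integrated fields in `L²`, and Cauchy–Schwarz
justifies the exchanges (`integral_mul_integral_comm`).

The delicate point is a jointly measurable version of `δ(u(x))`, which is defined separately for
each `x`. The variables `cos(∑ c(t) Bₜ + b)` lie in the domain of `D`, so duality makes their
pairing with `δ(u(x))` measurable in `x`. They are total in `L²(P)` because `B` generates the
σ-algebra, and path continuity makes `L²(P)` separable. Weak measurability then gives measurable
distances to fixed vectors, as in Pettis' theorem, and a countable selection gives the version.
Totality also makes `δ` unique almost surely. -/

instance sigmaFinite_lebesgue : SigmaFinite lebesgue := by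
  have h : MeasurableEmbedding ((↑) : ℝ≥0 → ℝ) :=
    MeasurableEmbedding.subtype_coe measurableSet_Ici
  refine SigmaFinite.of_map lebesgue h.measurable.aemeasurable ?_
  rw [lebesgue, h.map_comap]
  infer_instance

/-! ### Minkowski's integral inequality and exchange of integrals -/

section Minkowski

variable {α β : Type*} [MeasurableSpace α] [MeasurableSpace β] {μ : Measure α} {ν : Measure β}

theorem eLpNorm_two_eq (f : β → ℝ) :
    eLpNorm f 2 ν = (∫⁻ p, ‖f p‖ₑ ^ 2 ∂ν) ^ (1 / 2 : ℝ) := by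
  rw [eLpNorm_eq_lintegral_rpow_enorm_toReal (by simp) (by simp)]
  simp

theorem lintegral_mul_le_sqrt_mul_sqrt {f g : β → ℝ≥0∞} (hf : AEMeasurable f ν)
    (hg : AEMeasurable g ν) :
    ∫⁻ p, f p * g p ∂ν ≤
      (∫⁻ p, f p ^ 2 ∂ν) ^ (1 / 2 : ℝ) * (∫⁻ p, g p ^ 2 ∂ν) ^ (1 / 2 : ℝ) := by
  simpa using ENNReal.lintegral_mul_le_Lp_mul_Lq ν Real.HolderConjugate.two_two hf hg

/-- **Minkowski's integral inequality** for the exponent `2`. -/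
theorem lintegral_sq_lintegral_le [SFinite μ] [SFinite ν] {f : α → β → ℝ≥0∞}
    (hf : Measurable fun p : α × β => f p.1 p.2) :
    ∫⁻ p, (∫⁻ x, f x p ∂μ) ^ 2 ∂ν ≤ (∫⁻ x, (∫⁻ p, f x p ^ 2 ∂ν) ^ (1 / 2 : ℝ) ∂μ) ^ 2 := by
  have hx (x : α) : Measurable (f x) := hf.comp (measurable_prodMk_left (x := x))
  have hp (p : β) : Measurable fun x => f x p := hf.comp (measurable_prodMk_right (y := p))
  have hI : Measurable fun p => ∫⁻ x, f x p ∂μ := hf.lintegral_prod_left'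
  -- The square is expanded into a double integral over `(x, y)`, so that Cauchy–Schwarz in `p`
  -- applies to each pair.
  calc ∫⁻ p, (∫⁻ x, f x p ∂μ) ^ 2 ∂ν
      = ∫⁻ p, ∫⁻ x, f x p * ∫⁻ y, f y p ∂μ ∂μ ∂ν := by
        refine lintegral_congr fun p => ?_
        rw [lintegral_mul_const _ (hp p), sq]
    _ = ∫⁻ x, ∫⁻ p, f x p * ∫⁻ y, f y p ∂μ ∂ν ∂μ := by
        refine (lintegral_lintegral_swap ?_).symm
        exact (hf.mul (hI.comp measurable_snd)).aemeasurable
    _ = ∫⁻ x, ∫⁻ y, ∫⁻ p, f x p * f y p ∂ν ∂μ ∂μ := by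
        refine lintegral_congr fun x => ?_
        rw [lintegral_lintegral_swap]
        · refine lintegral_congr fun p => ?_
          rw [lintegral_const_mul _ (hp p)]
        · exact (((hx x).comp measurable_snd).mul hf).aemeasurable
    _ ≤ ∫⁻ x, ∫⁻ y, (∫⁻ p, f x p ^ 2 ∂ν) ^ (1 / 2 : ℝ) *
          (∫⁻ p, f y p ^ 2 ∂ν) ^ (1 / 2 : ℝ) ∂μ ∂μ :=
        lintegral_mono fun x => lintegral_mono fun y =>
          lintegral_mul_le_sqrt_mul_sqrt (hx x).aemeasurable (hx y).aemeasurable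
    _ = (∫⁻ x, (∫⁻ p, f x p ^ 2 ∂ν) ^ (1 / 2 : ℝ) ∂μ) ^ 2 := by
        have hm : Measurable fun x => (∫⁻ p, f x p ^ 2 ∂ν) ^ (1 / 2 : ℝ) :=
          ((hf.pow_const 2).lintegral_prod_right').pow_const _
        simp_rw [lintegral_const_mul _ hm]
        rw [lintegral_mul_const _ hm, sq]

variable [SFinite μ] [SFinite ν] {f : α → β → ℝ}

theorem lintegral_sq_lintegral_enorm_lt_top (hf : Measurable fun p : α × β => f p.1 p.2)
    (hfin : ∫⁻ x, (∫⁻ p, ‖f x p‖ₑ ^ 2 ∂ν) ^ (1 / 2 : ℝ) ∂μ < ∞) :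
    ∫⁻ p, (∫⁻ x, ‖f x p‖ₑ ∂μ) ^ 2 ∂ν < ∞ :=
  (lintegral_sq_lintegral_le (f := fun x p => ‖f x p‖ₑ) hf.enorm).trans_lt
    (ENNReal.pow_lt_top hfin)

theorem ae_integrable_of_lintegral_sqrt_lt_top (hf : Measurable fun p : α × β => f p.1 p.2)
    (hfin : ∫⁻ x, (∫⁻ p, ‖f x p‖ₑ ^ 2 ∂ν) ^ (1 / 2 : ℝ) ∂μ < ∞) :
    ∀ᵐ p ∂ν, Integrable (fun x => f x p) μ := by
  have hI : Measurable fun p => (∫⁻ x, ‖f x p‖ₑ ∂μ) ^ 2 :=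
    (Measurable.lintegral_prod_left' (f := fun p : α × β => ‖f p.1 p.2‖ₑ) hf.enorm).pow_const 2
  filter_upwards [ae_lt_top hI (lintegral_sq_lintegral_enorm_lt_top hf hfin).ne] with p hp
  refine ⟨(hf.comp (measurable_prodMk_right (y := p))).aestronglyMeasurable, ?_⟩
  by_contra h
  simp only [HasFiniteIntegral, not_lt, top_le_iff] at h
  simp [h] at hp

theorem memLp_two_integral (hf : Measurable fun p : α × β => f p.1 p.2)
    (hfin : ∫⁻ x, (∫⁻ p, ‖f x p‖ₑ ^ 2 ∂ν) ^ (1 / 2 : ℝ) ∂μ < ∞) :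
    MemLp (fun p => ∫ x, f x p ∂μ) 2 ν := by
  refine ⟨(hf.stronglyMeasurable.integral_prod_left').aestronglyMeasurable, ?_⟩
  rw [eLpNorm_two_eq]
  refine ENNReal.rpow_lt_top_of_nonneg (by norm_num) (ne_of_lt ?_)
  refine lt_of_le_of_lt (lintegral_mono fun p => ?_) (lintegral_sq_lintegral_enorm_lt_top hf hfin)
  gcongr
  exact enorm_integral_le_lintegral_enorm _

theorem integral_mul_integral_comm (hf : Measurable fun p : α × β => f p.1 p.2)
    (hfin : ∫⁻ x, (∫⁻ p, ‖f x p‖ₑ ^ 2 ∂ν) ^ (1 / 2 : ℝ) ∂μ < ∞) {g : β → ℝ} (hg : MemLp g 2 ν) :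
    ∫ p, g p * ∫ x, f x p ∂μ ∂ν = ∫ x, ∫ p, g p * f x p ∂ν ∂μ := by
  have hx (x : α) : Measurable (f x) := hf.comp (measurable_prodMk_left (x := x))
  simp_rw [← integral_const_mul]
  refine (integral_integral_swap ?_).symm
  have hmeas : AEStronglyMeasurable (fun z : α × β => g z.2 * f z.1 z.2) (μ.prod ν) :=
    hg.1.comp_snd.mul hf.aestronglyMeasurable
  refine ⟨hmeas, ?_⟩
  change ∫⁻ z : α × β, ‖g z.2 * f z.1 z.2‖ₑ ∂μ.prod ν < ∞
  rw [lintegral_prod _ hmeas.enorm]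
  simp only [enorm_mul]
  refine lt_of_le_of_lt (lintegral_mono fun x =>
    lintegral_mul_le_sqrt_mul_sqrt hg.1.enorm (hx x).enorm.aemeasurable) ?_
  have hm : Measurable fun x => (∫⁻ p, ‖f x p‖ₑ ^ 2 ∂ν) ^ (1 / 2 : ℝ) :=
    ((hf.enorm.pow_const 2).lintegral_prod_right').pow_const _
  rw [lintegral_const_mul _ hm]
  refine ENNReal.mul_lt_top ?_ hfin
  rw [← eLpNorm_two_eq]
  exact hg.2

end Minkowski

/-! ### Weak measurability and joint versions of `L²`-valued maps -/

section WeakMeasurability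

variable {X : Type*} [MeasurableSpace X]

theorem measurable_inner_of_mem_closure_span {E : Type*} [NormedAddCommGroup E]
    [InnerProductSpace ℝ E] {S : Set E} {v : X → E}
    (hS : ∀ w ∈ S, Measurable fun x => inner ℝ w (v x)) {w : E}
    (hw : w ∈ (Submodule.span ℝ S).topologicalClosure) : Measurable fun x => inner ℝ w (v x) := by
  have hspan (w : E) (hw : w ∈ Submodule.span ℝ S) : Measurable fun x => inner ℝ w (v x) := by
    induction hw using Submodule.span_induction with
    | mem w h => exact hS w h
    | zero => simp
    | add w w' _ _ h h' => simpa only [inner_add_left] using h.fun_add h'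
    | smul a w _ h => simpa only [real_inner_smul_left] using h.const_mul a
  obtain ⟨s, hs, hlim⟩ := mem_closure_iff_seq_limit.1 hw
  refine measurable_of_tendsto_metrizable (fun n => hspan (s n) (hs n))
    (tendsto_pi_nhds.2 fun x => ?_)
  exact hlim.inner tendsto_const_nhds

/-- A bound `‖v‖ ≤ r` with `r ≥ 0` amounts to `⟪w, v⟫ ≤ ‖w‖ r` for `w` in a countable dense set. -/
theorem measurable_norm_of_measurable_inner {E : Type*} [NormedAddCommGroup E]
    [InnerProductSpace ℝ E] [TopologicalSpace.SeparableSpace E] {v : X → E}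
    (h : ∀ w, Measurable fun x => inner ℝ w (v x)) : Measurable fun x => ‖v x‖ := by
  refine measurable_of_Iic fun r => ?_
  rcases lt_or_ge r 0 with hr | hr
  · convert MeasurableSet.empty
    ext x
    simpa using hr.trans_le (norm_nonneg _)
  have hset : (fun x => ‖v x‖) ⁻¹' Set.Iic r =
      ⋂ k, {x | inner ℝ (TopologicalSpace.denseSeq E k) (v x) ≤
        ‖TopologicalSpace.denseSeq E k‖ * r} := by
    ext x
    simp only [Set.mem_preimage, Set.mem_Iic, Set.mem_iInter, Set.mem_ofPred_eq]
    refine ⟨fun hx k => (real_inner_le_norm _ _).trans (by gcongr), fun hx => ?_⟩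
    have hcl : IsClosed {w : E | inner ℝ w (v x) ≤ ‖w‖ * r} :=
      isClosed_le (by fun_prop) (by fun_prop)
    -- The inequality is closed in `w`, hence extends from the dense sequence to `w = v x`, where it
    -- reads `‖v x‖² ≤ ‖v x‖ r`.
    have hv : v x ∈ {w : E | inner ℝ w (v x) ≤ ‖w‖ * r} :=
      hcl.closure_subset_iff.2 (Set.range_subset_iff.2 hx)
        (TopologicalSpace.denseRange_denseSeq E (v x))
    rcases eq_or_ne (v x) 0 with h0 | h0
    · simpa [h0] using hr
    · simp only [Set.mem_ofPred_eq, real_inner_self_eq_norm_mul_norm] at hv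
      exact le_of_mul_le_mul_left hv (norm_pos_iff.2 h0)
  rw [hset]
  exact MeasurableSet.iInter fun k => measurableSet_le (h _) measurable_const

variable {Ω : Type*} [MeasurableSpace Ω] {P : Measure Ω}

/-- Taking the first term of a dense sequence within `2⁻ⁿ` of `v x` involves only countably many
representatives, so joint measurability is automatic. -/
theorem exists_measurable_approx [TopologicalSpace.SeparableSpace (Lp ℝ 2 P)]
    {v : X → Lp ℝ 2 P} (hv : ∀ d, Measurable fun x => ‖v x - d‖) :
    ∃ f : ℕ → X × Ω → ℝ, (∀ n, Measurable (f n)) ∧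
      ∀ n x, ∃ w : Lp ℝ 2 P, ‖w - v x‖ ≤ (1 / 2) ^ n ∧ ∀ ω, f n (x, ω) = w ω := by
  classical
  have hex (n : ℕ) (x : X) :
      ∃ k, ‖v x - TopologicalSpace.denseSeq (Lp ℝ 2 P) k‖ < (1 / 2 : ℝ) ^ n := by
    obtain ⟨k, hk⟩ := (TopologicalSpace.denseRange_denseSeq (Lp ℝ 2 P)).exists_dist_lt (v x)
      (ε := (1 / 2 : ℝ) ^ n) (by positivity)
    exact ⟨k, by rwa [dist_eq_norm] at hk⟩
  have h : Measurable fun q : ℕ × Ω => TopologicalSpace.denseSeq (Lp ℝ 2 P) q.1 q.2 :=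
    measurable_from_prod_countable_right fun k =>
      (Lp.stronglyMeasurable (TopologicalSpace.denseSeq (Lp ℝ 2 P) k)).measurable
  have hfind (n : ℕ) : Measurable fun x => Nat.find (hex n x) :=
    measurable_find (hex n) fun k => measurableSet_lt (hv _) measurable_const
  refine ⟨fun n p => TopologicalSpace.denseSeq (Lp ℝ 2 P) (Nat.find (hex n p.1)) p.2,
    fun n => h.comp (((hfind n).comp measurable_fst).prodMk measurable_snd), fun n x =>
      ⟨TopologicalSpace.denseSeq (Lp ℝ 2 P) (Nat.find (hex n x)), ?_, fun _ => rfl⟩⟩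
  rw [norm_sub_rev]
  exact (Nat.find_spec (hex n x)).le

theorem lintegral_enorm_sub_le [IsProbabilityMeasure P] (w v : Lp ℝ 2 P) :
    ∫⁻ ω, ‖w ω - v ω‖ₑ ∂P ≤ ‖w - v‖ₑ := by
  rw [Lp.enorm_def, ← eLpNorm_one_eq_lintegral_enorm,
    eLpNorm_congr_ae (Lp.coeFn_sub w v)]
  exact eLpNorm_le_eLpNorm_of_exponent_le (by norm_num)
    ((Lp.aestronglyMeasurable w).sub (Lp.aestronglyMeasurable v))

theorem exists_measurable_version [IsProbabilityMeasure P]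
    [TopologicalSpace.SeparableSpace (Lp ℝ 2 P)] {v : X → Lp ℝ 2 P}
    (hv : ∀ d, Measurable fun x => ‖v x - d‖) :
    ∃ Z : X → Ω → ℝ, Measurable (fun p : X × Ω => Z p.1 p.2) ∧ ∀ x, Z x =ᵐ[P] v x := by
  obtain ⟨f, hf, happrox⟩ := exists_measurable_approx hv
  -- The `L¹` errors are at most `2⁻ⁿ`, hence summable, which forces almost sure convergence for
  -- each `x`; the limsup is jointly measurable even where convergence fails.
  refine ⟨fun x ω => limsup (fun n => f n (x, ω)) atTop, Measurable.limsup hf, fun x => ?_⟩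
  have hbound (n : ℕ) : ∫⁻ ω, ‖f n (x, ω) - v x ω‖ₑ ∂P ≤ (1 / 2) ^ n := by
    obtain ⟨w, hw, hfw⟩ := happrox n x
    simp_rw [hfw]
    refine (lintegral_enorm_sub_le w (v x)).trans ?_
    rw [← ofReal_norm]
    refine (ENNReal.ofReal_le_ofReal hw).trans_eq ?_
    rw [ENNReal.ofReal_pow (by norm_num), ENNReal.ofReal_div_of_pos (by norm_num)]
    simp
  have hm (n : ℕ) : AEMeasurable (fun ω => ‖f n (x, ω) - v x ω‖ₑ) P :=
    (((hf n).comp measurable_prodMk_left).sub (Lp.stronglyMeasurable 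
      (v x)).measurable).enorm.aemeasurable
  have hsum : ∫⁻ ω, ∑' n, ‖f n (x, ω) - v x ω‖ₑ ∂P ≠ ∞ := by
    rw [lintegral_tsum hm]
    refine ne_top_of_le_ne_top ?_ (ENNReal.tsum_le_tsum hbound)
    rw [ENNReal.tsum_geometric]
    simp
  filter_upwards [ae_lt_top' (AEMeasurable.tsum hm) hsum] with ω hω
  refine Tendsto.limsup_eq ?_
  rw [tendsto_iff_edist_tendsto_0]
  simpa only [edist_eq_enorm_sub] using ENNReal.tendsto_atTop_zero_of_tsum_ne_top hω.ne

end WeakMeasurability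

/-! ### Trigonometric test variables -/

variable {Ω : Type*} [MeasurableSpace Ω] {P : Measure Ω} {B : ℝ≥0 → Ω → ℝ}

theorem hasTemperateGrowth_cos : Real.cos.HasTemperateGrowth := by
  refine ⟨Real.contDiff_cos, fun n => ⟨0, 1, fun x => ?_⟩⟩
  rw [norm_iteratedFDeriv_eq_norm_iteratedDeriv]
  simpa using Real.abs_iteratedDeriv_cos_le_one n x

theorem measurable_stepFun (c : ℝ≥0 →₀ ℝ) : Measurable (stepFun c) := by
  unfold stepFun Finsupp.sum
  exact Finset.measurable_fun_sum _ fun t _ =>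
    (measurable_const.indicator measurableSet_Iic).const_mul _

theorem measurable_stepIntegral (hB : ∀ t, Measurable (B t)) (c : ℝ≥0 →₀ ℝ) :
    Measurable (stepIntegral B c) := by
  unfold stepIntegral Finsupp.sum
  exact Finset.measurable_fun_sum _ fun t _ => (hB t).const_mul _

theorem lebesgue_Iic_lt_top (t : ℝ≥0) : lebesgue (Set.Iic t) < ∞ := by
  have h : MeasurableEmbedding ((↑) : ℝ≥0 → ℝ) :=
    MeasurableEmbedding.subtype_coe measurableSet_Ici
  rw [lebesgue, h.comap_apply]
  refine lt_of_le_of_lt (measure_mono (t := Set.Icc 0 (t : ℝ)) ?_) measure_Icc_lt_top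
  rintro _ ⟨s, hs, rfl⟩
  exact ⟨s.2, NNReal.coe_le_coe.2 hs⟩

theorem memLp_stepFun (c : ℝ≥0 →₀ ℝ) : MemLp (stepFun c) 2 lebesgue := by
  unfold stepFun Finsupp.sum
  exact memLp_finsetSum _ fun t _ =>
    (memLp_indicator_const 2 measurableSet_Iic 1 (Or.inr (lebesgue_Iic_lt_top t).ne)).const_mul _

theorem memLp_stepIntegral (hB : IsPreBrownianReal B P) (c : ℝ≥0 →₀ ℝ) :
    MemLp (stepIntegral B c) 2 P := by
  unfold stepIntegral Finsupp.sum
  exact memLp_finsetSum _ fun t _ =>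
    ((hB.isGaussianProcess.hasGaussianLaw_eval t).memLp_two).const_mul _

theorem isWienerIntegral_stepIntegral (hB : IsPreBrownianReal B P) (c : ℝ≥0 →₀ ℝ) :
    IsWienerIntegral B P (stepFun c) (stepIntegral B c) :=
  ⟨memLp_stepFun c, memLp_stepIntegral hB c, fun _ => c, by simp, by simp⟩

/-- The random variable `cos (∑ₜ c(t) Bₜ + b)`. -/
noncomputable def trigRV (B : ℝ≥0 → Ω → ℝ) (b : ℝ) (c : ℝ≥0 →₀ ℝ) (ω : Ω) : ℝ :=
  Real.cos (stepIntegral B c ω + b)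

/-- The Malliavin derivative of `cos (∑ₜ c(t) Bₜ + b)`. -/
noncomputable def trigDeriv (B : ℝ≥0 → Ω → ℝ) (b : ℝ) (c : ℝ≥0 →₀ ℝ) (s : ℝ≥0) (ω : Ω) : ℝ :=
  -Real.sin (stepIntegral B c ω + b) * stepFun c s

theorem measurable_trigRV (hB : ∀ t, Measurable (B t)) (b : ℝ) (c : ℝ≥0 →₀ ℝ) :
    Measurable (trigRV B b c) :=
  Real.measurable_cos.comp ((measurable_stepIntegral hB c).add_const b)

theorem measurable_trigDeriv (hB : ∀ t, Measurable (B t)) (b : ℝ) (c : ℝ≥0 →₀ ℝ) :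
    Measurable fun p : ℝ≥0 × Ω => trigDeriv B b c p.1 p.2 :=
  (Real.measurable_sin.comp (((measurable_stepIntegral hB c).comp measurable_snd).add_const
    b)).neg.mul ((measurable_stepFun c).comp measurable_fst)

omit [MeasurableSpace Ω] in
theorem norm_trigRV_le (b : ℝ) (c : ℝ≥0 →₀ ℝ) (ω : Ω) : ‖trigRV B b c ω‖ ≤ 1 :=
  Real.abs_cos_le_one _

theorem memLp_trigRV [IsFiniteMeasure P] (hB : ∀ t, Measurable (B t)) (b : ℝ) (c : ℝ≥0 →₀ ℝ) :
    MemLp (trigRV B b c) 2 P :=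
  MemLp.of_bound (measurable_trigRV hB b c).aestronglyMeasurable 1
    (Eventually.of_forall (norm_trigRV_le b c))

theorem memLp_trigDeriv [IsFiniteMeasure P] (hB : ∀ t, Measurable (B t)) (b : ℝ)
    (c : ℝ≥0 →₀ ℝ) :
    MemLp (fun p : ℝ≥0 × Ω => trigDeriv B b c p.1 p.2) 2 (lebesgue.prod P) := by
  refine ((memLp_stepFun c).comp_fst P).mono (measurable_trigDeriv hB b c).aestronglyMeasurable
    (Eventually.of_forall fun p => ?_)
  rw [trigDeriv, norm_mul, norm_neg]
  exact mul_le_of_le_one_left (norm_nonneg _) (Real.abs_sin_le_one _)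

theorem isSmoothRV_trigRV (hB : IsPreBrownianReal B P) (b : ℝ) (c : ℝ≥0 →₀ ℝ) :
    IsSmoothRV B P (trigRV B b c) (trigDeriv B b c) := by
  have hd (x : Fin 1 → ℝ) : HasFDerivAt (fun y : Fin 1 → ℝ => Real.cos (y 0 + b))
      (-Real.sin (x 0 + b) • ContinuousLinearMap.proj (R := ℝ) (φ := fun _ : Fin 1 => ℝ) 0) x :=
    ((hasFDerivAt_apply (𝕜 := ℝ) (0 : Fin 1) x).add_const b).cos
  refine ⟨1, fun x => Real.cos (x 0 + b), fun _ => stepFun c, fun _ => stepIntegral B c, ?_,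
    fun _ => isWienerIntegral_stepIntegral hB c, fun _ => rfl, fun t ω => ?_⟩
  · have h : Function.HasTemperateGrowth fun x : Fin 1 → ℝ => x 0 + b :=
      (ContinuousLinearMap.proj (R := ℝ) (φ := fun _ : Fin 1 => ℝ) 0).hasTemperateGrowth.add
        (.const b)
    exact hasTemperateGrowth_cos.comp h
  · simp [(hd _).fderiv, trigDeriv]

theorem isMalliavinDeriv_trigRV [IsFiniteMeasure P] (hB : IsPreBrownianReal B P)
    (hBm : ∀ t, Measurable (B t)) (b : ℝ) (c : ℝ≥0 →₀ ℝ) :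
    IsMalliavinDeriv B P (trigRV B b c) (trigDeriv B b c) :=
  ⟨memLp_trigRV hBm b c, memLp_trigDeriv hBm b c, fun _ => trigRV B b c,
    fun _ => trigDeriv B b c, fun _ => isSmoothRV_trigRV hB b c, by simp, by simp⟩

/-! ### Totality of the test variables -/

theorem integral_withDensity_sub_integral_withDensity {Y : Ω → ℝ} (hY : Integrable Y P)
    {φ : Ω → ℂ} (hφ : Measurable φ) {C : ℝ} (hC : ∀ ω, ‖φ ω‖ ≤ C) :
    (∫ ω, φ ω ∂P.withDensity fun ω => ENNReal.ofReal (Y ω)) -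
      (∫ ω, φ ω ∂P.withDensity fun ω => ENNReal.ofReal (-Y ω)) = ∫ ω, Y ω • φ ω ∂P := by
  rw [integral_withDensity_eq_integral_toReal_smul₀ hY.1.aemeasurable.ennreal_ofReal
      (Eventually.of_forall fun _ => ENNReal.ofReal_lt_top),
    integral_withDensity_eq_integral_toReal_smul₀ hY.1.aemeasurable.fun_neg.ennreal_ofReal
      (Eventually.of_forall fun _ => ENNReal.ofReal_lt_top), ← integral_sub]
  · refine integral_congr_ae (Eventually.of_forall fun ω => ?_)
    simp only [← sub_smul]
    congr 1
    rw [ENNReal.toReal_ofReal', ENNReal.toReal_ofReal']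
    rcases le_total (Y ω) 0 with h | h
    · rw [max_eq_right h, max_eq_left (neg_nonneg.2 h)]; ring
    · rw [max_eq_left h, max_eq_right (neg_nonpos.2 h)]; ring
  · have h : Integrable (fun ω => (ENNReal.ofReal (Y ω)).toReal) P := by
      simpa only [ENNReal.toReal_ofReal'] using hY.pos_part
    exact h.smul_bdd C hφ.aestronglyMeasurable (Eventually.of_forall hC)
  · have h : Integrable (fun ω => (ENNReal.ofReal (-Y ω)).toReal) P := by
      simpa only [ENNReal.toReal_ofReal'] using hY.neg_part
    exact h.smul_bdd C hφ.aestronglyMeasurable (Eventually.of_forall hC)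

omit [MeasurableSpace Ω] in
theorem iSup_comap_eq_comap_pi :
    (⨆ t, MeasurableSpace.comap (B t) (borel ℝ)) =
      MeasurableSpace.comap (fun ω t => B t ω) MeasurableSpace.pi := by
  rw [MeasurableSpace.pi, MeasurableSpace.comap_iSup]
  refine iSup_congr fun t => ?_
  rw [MeasurableSpace.comap_comp, BorelSpace.measurable_eq (α := ℝ)]
  rfl

-- This expresses the characteristic functions of the finite-dimensional marginals of `B` through
-- step integrals.
omit [MeasurableSpace Ω] in
theorem exists_stepIntegral_eq (I : Finset ℝ≥0) (L : (I → ℝ) →L[ℝ] ℝ) :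
    ∃ c : ℝ≥0 →₀ ℝ, ∀ ω, L (I.restrict fun t => B t ω) = stepIntegral B c ω := by
  classical
  refine ⟨∑ i : I, Finsupp.single (i : ℝ≥0) (L (Pi.single i 1)), fun ω => ?_⟩
  rw [stepIntegral, ← Finsupp.sum_finsetSum_index (by simp) (by intros; ring)]
  simp only [zero_mul, Finsupp.sum_single_index]
  conv_lhs => rw [← LinearMap.sum_single_apply (φ := fun _ : I => ℝ) (I.restrict fun t => B t ω)]
  rw [map_sum]
  refine Finset.sum_congr rfl fun i _ => ?_
  have : (Pi.single i (I.restrict (fun t => B t ω) i) : I → ℝ) =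
      B i ω • (Pi.single i (1 : ℝ) : I → ℝ) := by
    ext j
    simp [Pi.single_apply]
  rw [this, map_smul, smul_eq_mul, mul_comm]

/-- The random variables `cos (∑ₜ c(t) Bₜ + b)` are total in `L²`. -/
theorem ae_eq_zero_of_integral_trigRV_mul [IsFiniteMeasure P] (hB : ∀ t, Measurable (B t))
    (hgen : GeneratedBy B P) {Y : Ω → ℝ} (hY : MemLp Y 2 P)
    (h : ∀ b c, ∫ ω, trigRV B b c ω * Y ω ∂P = 0) : Y =ᵐ[P] 0 := by
  have hYi : Integrable Y P := hY.integrable (by norm_num)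
  -- The signed measure `Y dP` is split into its positive and negative parts; the goal is `ν₁ = ν₂`.
  set ν₁ := P.withDensity fun ω => ENNReal.ofReal (Y ω)
  set ν₂ := P.withDensity fun ω => ENNReal.ofReal (-Y ω)
  have hfin₁ : IsFiniteMeasure ν₁ := isFiniteMeasure_withDensity_ofReal hYi.2
  have hfin₂ : IsFiniteMeasure ν₂ := isFiniteMeasure_withDensity_ofReal hYi.neg.2
  have hX : Measurable fun ω t => B t ω := measurable_pi_lambda _ hB
  have hmap : ν₁.map (fun ω t => B t ω) = ν₂.map (fun ω t => B t ω) := by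
    refine IsProjectiveLimit.unique
      (P := fun I : Finset ℝ≥0 => (ν₁.map fun ω t => B t ω).map I.restrict)
      (fun I => rfl) fun I => ?_
    refine Measure.ext_of_charFunDual (funext fun L => ?_)
    obtain ⟨c, hc⟩ := exists_stepIntegral_eq (B := B) I L
    have hcm := measurable_stepIntegral hB c
    have hφ : Measurable fun ω => Complex.exp (stepIntegral B c ω * Complex.I) := by fun_prop
    have hr : Measurable (I.restrict : (ℝ≥0 → ℝ) → (I → ℝ)) := Finset.measurable_restrict I
    have hchar (ν : Measure Ω) : charFunDual ((ν.map fun ω t => B t ω).map I.restrict) L =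
        ∫ ω, Complex.exp (stepIntegral B c ω * Complex.I) ∂ν := by
      rw [Measure.map_map hr hX, charFunDual_apply,
        integral_map (hr.comp hX).aemeasurable (by fun_prop)]
      simp only [Function.comp_apply, hc]
    rw [hchar, hchar, eq_comm, ← sub_eq_zero,
      integral_withDensity_sub_integral_withDensity hYi hφ (C := 1)
        (fun ω => (Complex.norm_exp_ofReal_mul_I _).le)]
    have hint : Integrable (fun ω => Y ω • Complex.exp (stepIntegral B c ω * Complex.I)) P :=
      Integrable.smul_bdd (C := 1) hYi hφ.aestronglyMeasurable
        (Eventually.of_forall fun ω => (Complex.norm_exp_ofReal_mul_I _).le)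
    -- The phases `0` and `-π/2` yield the cosine and the sine, the two parts of the complex
    -- exponential.
    have hre := h 0 c
    have him := h (-(Real.pi / 2)) c
    simp only [trigRV, add_zero, ← sub_eq_add_neg, Real.cos_sub_pi_div_two] at hre him
    rw [← integral_re_add_im hint]
    simp [Complex.exp_ofReal_mul_I_re, Complex.exp_ofReal_mul_I_im, mul_comm (Y _), hre, him]
  -- Both measures vanish on `P`-null sets, so every event may be replaced by one determined by the
  -- path of `B`.
  have hν : ν₁ = ν₂ := by
    ext s hs
    obtain ⟨s', hs', hss⟩ := hgen s hs
    rw [iSup_comap_eq_comap_pi] at hs'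
    obtain ⟨T, hT, rfl⟩ := hs'
    rw [measure_congr ((withDensity_absolutelyContinuous P _).ae_le hss),
      ← Measure.map_apply hX hT, hmap, Measure.map_apply hX hT,
      measure_congr ((withDensity_absolutelyContinuous P _).ae_le hss)]
  have hae := (withDensity_eq_iff hYi.1.aemeasurable.ennreal_ofReal
    hYi.1.aemeasurable.fun_neg.ennreal_ofReal (by
      have := measure_ne_top ν₁ Set.univ
      rwa [withDensity_apply _ .univ, Measure.restrict_univ] at this)).1 hν
  filter_upwards [hae] with ω hω
  rcases le_total (Y ω) 0 with h0 | h0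
  · rw [ENNReal.ofReal_of_nonpos h0, eq_comm, ENNReal.ofReal_eq_zero] at hω
    exact le_antisymm h0 (by simpa using hω)
  · rw [ENNReal.ofReal_of_nonpos (neg_nonpos.2 h0), ENNReal.ofReal_eq_zero] at hω
    exact le_antisymm hω h0

/-! ### Uniqueness of `δ` and separability of `L²(P)` -/

theorem IsSkorohodIntegral.ae_eq [IsFiniteMeasure P] (hB : IsPreBrownianReal B P)
    (hBm : ∀ t, Measurable (B t)) (hgen : GeneratedBy B P) {u : ℝ≥0 → Ω → ℝ} {Y Z : Ω → ℝ}
    (hY : IsSkorohodIntegral B P u Y) (hZ : IsSkorohodIntegral B P u Z) : Y =ᵐ[P] Z := by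
  have h0 := ae_eq_zero_of_integral_trigRV_mul hBm hgen (hY.2.1.sub hZ.2.1) fun b c => by
    have hD := isMalliavinDeriv_trigRV hB hBm b c
    simp only [Pi.sub_apply, mul_sub]
    rw [integral_sub (f := fun ω => trigRV B b c ω * Y ω) (g := fun ω => trigRV B b c ω * Z ω)
        (hD.1.integrable_mul hY.2.1) (hD.1.integrable_mul hZ.2.1),
      hY.2.2 _ _ hD, hZ.2.2 _ _ hD, sub_self]
  filter_upwards [h0] with ω hω using sub_eq_zero.1 hω

theorem SkorohodIntegrable.isSkorohodIntegral {u : ℝ≥0 → Ω → ℝ} (hu : SkorohodIntegrable B P u) :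
    IsSkorohodIntegral B P u (skorohod B P u) := by
  rw [skorohod, dif_pos hu]
  exact hu.choose_spec

theorem topologicalClosure_span_trigRV [IsFiniteMeasure P] (hBm : ∀ t, Measurable (B t))
    (hgen : GeneratedBy B P) :
    (Submodule.span ℝ (Set.range fun q : ℝ × (ℝ≥0 →₀ ℝ) =>
      (memLp_trigRV (P := P) hBm q.1 q.2).toLp _)).topologicalClosure = ⊤ := by
  rw [Submodule.topologicalClosure_eq_top_iff, Submodule.eq_bot_iff]
  intro v hv
  rw [Lp.eq_zero_iff_ae_eq_zero]
  refine ae_eq_zero_of_integral_trigRV_mul hBm hgen (Lp.memLp v) fun b c => ?_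
  have h := (Submodule.mem_orthogonal _ _).1 hv _ (Submodule.subset_span ⟨(b, c), rfl⟩)
  rw [L2.inner_def] at h
  rw [← h]
  refine integral_congr_ae ?_
  filter_upwards [(memLp_trigRV (P := P) hBm b c).coeFn_toLp] with ω hω
  simp [hω, mul_comm]

omit [MeasurableSpace Ω] in
theorem stepIntegral_sum_single {ι : Type*} [Fintype ι] (t : ι → ℝ≥0) (a : ι → ℝ) (ω : Ω) :
    stepIntegral B (∑ i, Finsupp.single (t i) (a i)) ω = ∑ i, a i * B (t i) ω := by
  rw [stepIntegral, ← Finsupp.sum_finsetSum_index (by simp) (by intros; ring)]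
  simp

/-- Almost sure path continuity gives pointwise convergence, and boundedness of the cosine gives
domination. -/
theorem continuous_toLp_trigRV [IsFiniteMeasure P] (hB : IsBrownianReal B P)
    (hBm : ∀ t, Measurable (B t)) (n : ℕ) :
    Continuous fun q : (Fin n → ℝ≥0) × (Fin n → ℝ) × ℝ =>
      (memLp_trigRV (P := P) hBm q.2.2
        (∑ i, Finsupp.single (q.1 i) (q.2.1 i))).toLp _ := by
  refine continuous_iff_seqContinuous.2 fun z q hz => ?_
  rw [Function.comp_def, Lp.tendsto_Lp_iff_tendsto_eLpNorm'']
  simp_rw [eLpNorm_two_eq]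
  have hm (b : ℝ) (c : ℝ≥0 →₀ ℝ) := measurable_trigRV hBm b c
  have hlim : Tendsto (fun k => ∫⁻ ω, ‖(trigRV B (z k).2.2
      (∑ i, Finsupp.single ((z k).1 i) ((z k).2.1 i)) -
        trigRV B q.2.2 (∑ i, Finsupp.single (q.1 i) (q.2.1 i))) ω‖ₑ ^ 2 ∂P) atTop
      (𝓝 (∫⁻ _, 0 ∂P)) := by
    refine tendsto_lintegral_of_dominated_convergence (fun _ => 2 ^ 2)
      (fun k => (((hm _ _).sub (hm _ _)).enorm.pow_const 2))
      (fun k => Eventually.of_forall fun ω => ?_)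
      (by simpa using (ENNReal.mul_lt_top (by simp) (measure_lt_top P Set.univ)).ne) ?_
    · refine pow_le_pow_left' ?_ 2
      rw [← ofReal_norm]
      refine ENNReal.ofReal_le_of_le_toReal ((norm_sub_le _ _).trans ?_)
      have := norm_trigRV_le (B := B) (z k).2.2 (∑ i, Finsupp.single ((z k).1 i) ((z k).2.1 i)) ω
      have := norm_trigRV_le (B := B) q.2.2 (∑ i, Finsupp.single (q.1 i) (q.2.1 i)) ω
      rw [ENNReal.toReal_ofNat]
      linarith
    · filter_upwards [hB.cont] with ω hω
      have hcont : Continuous fun q : (Fin n → ℝ≥0) × (Fin n → ℝ) × ℝ =>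
          trigRV B q.2.2 (∑ i, Finsupp.single (q.1 i) (q.2.1 i)) ω := by
        simp only [trigRV, stepIntegral_sum_single]
        have h (i : Fin n) : Continuous fun q : (Fin n → ℝ≥0) × (Fin n → ℝ) × ℝ => B (q.1 i) ω :=
          hω.comp (by fun_prop)
        fun_prop
      have h0 := ((hcont.tendsto q).comp hz).sub_const
        (trigRV B q.2.2 (∑ i, Finsupp.single (q.1 i) (q.2.1 i)) ω)
      have h1 := (ENNReal.continuous_pow 2).tendsto _ |>.comp h0.enorm
      simpa [Function.comp_def] using h1
  simpa [Function.comp_def] using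
    ((ENNReal.continuous_rpow_const (y := 1 / 2)).tendsto _).comp hlim

/-- The total family is a countable union, over the number of time points, of continuous images of
separable parameter spaces. -/
theorem separableSpace_Lp_two [IsFiniteMeasure P] (hB : IsBrownianReal B P)
    (hBm : ∀ t, Measurable (B t)) (hgen : GeneratedBy B P) :
    TopologicalSpace.SeparableSpace (Lp ℝ 2 P) := by
  rw [← TopologicalSpace.isSeparable_univ_iff]
  have hS : TopologicalSpace.IsSeparable (Set.range fun q : ℝ × (ℝ≥0 →₀ ℝ) =>
      (memLp_trigRV (P := P) hBm q.1 q.2).toLp _) := by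
    refine (TopologicalSpace.IsSeparable.iUnion fun n =>
      TopologicalSpace.isSeparable_range (continuous_toLp_trigRV hB hBm n)).mono ?_
    rintro _ ⟨⟨b, c⟩, rfl⟩
    let e := c.support.equivFin.symm
    refine Set.mem_iUnion.2 ⟨c.support.card, (fun i => e i, fun i => c (e i), b), ?_⟩
    have hc : ∑ i, Finsupp.single (e i : ℝ≥0) (c (e i)) = c := by
      rw [e.sum_comp (fun t : c.support => Finsupp.single (t : ℝ≥0) (c t)),
        Finset.sum_coe_sort c.support (fun t => Finsupp.single t (c t))]
      exact c.sum_single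
    simp only [hc]
  have h := (hS.span (R := ℝ)).closure
  rw [← Submodule.topologicalClosure_coe, topologicalClosure_span_trigRV hBm hgen] at h
  exact h

theorem IsSkorohodIntegral.congr {u : ℝ≥0 → Ω → ℝ} {Y Z : Ω → ℝ}
    (hY : IsSkorohodIntegral B P u Y) (h : Z =ᵐ[P] Y) : IsSkorohodIntegral B P u Z := by
  refine ⟨hY.1, hY.2.1.ae_eq h.symm, fun F DF hF => ?_⟩
  rw [← hY.2.2 F DF hF]
  refine integral_congr_ae ?_
  filter_upwards [h] with ω hω
  rw [hω]

theorem integral_prod_mul_eq [SFinite P] {D u : ℝ≥0 → Ω → ℝ}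
    (hD : MemLp (fun p : ℝ≥0 × Ω => D p.1 p.2) 2 (lebesgue.prod P))
    (hu : MemLp (fun p : ℝ≥0 × Ω => u p.1 p.2) 2 (lebesgue.prod P)) :
    ∫ p : ℝ≥0 × Ω, D p.1 p.2 * u p.1 p.2 ∂lebesgue.prod P =
      ∫ ω, ∫ t, D t ω * u t ω ∂lebesgue ∂P :=
  integral_prod_symm (fun p : ℝ≥0 × Ω => D p.1 p.2 * u p.1 p.2) (hD.integrable_mul hu)

/-! ### Duality and the Fubini theorem -/

section Fubini

variable {X : Type*} [MeasurableSpace X] {u : ℝ≥0 → X → Ω → ℝ}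

theorem measurable_swap_field (hu : Measurable fun p : ℝ≥0 × X × Ω => u p.1 p.2.1 p.2.2) :
    Measurable fun p : X × ℝ≥0 × Ω => u p.2.1 p.1 p.2.2 :=
  hu.comp (measurable_snd.fst.prodMk (measurable_fst.prodMk measurable_snd.snd))

/-- The Skorohod integral commutes with the integral over a parameter. -/
theorem isSkorohodIntegral_integral [SFinite P] {μ : Measure X} [SFinite μ] {Y : X → Ω → ℝ}
    (hu : Measurable fun p : ℝ≥0 × X × Ω => u p.1 p.2.1 p.2.2)
    (hY : Measurable fun p : X × Ω => Y p.1 p.2)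
    (h₁ : ∫⁻ x, (∫⁻ p : ℝ≥0 × Ω, ‖u p.1 x p.2‖ₑ ^ 2 ∂lebesgue.prod P) ^ (1 / 2 : ℝ) ∂μ < ∞)
    (h₂ : ∫⁻ x, (∫⁻ ω, ‖Y x ω‖ₑ ^ 2 ∂P) ^ (1 / 2 : ℝ) ∂μ < ∞)
    (h : ∀ᵐ x ∂μ, IsSkorohodIntegral B P (fun t ω => u t x ω) (Y x)) :
    IsSkorohodIntegral B P (fun t ω => ∫ x, u t x ω ∂μ) fun ω => ∫ x, Y x ω ∂μ := by
  have hu' := measurable_swap_field hu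
  have hU : MemLp (fun p : ℝ≥0 × Ω => ∫ x, u p.1 x p.2 ∂μ) 2 (lebesgue.prod P) :=
    memLp_two_integral (f := fun x (p : ℝ≥0 × Ω) => u p.1 x p.2) hu' h₁
  refine ⟨hU, memLp_two_integral hY h₂, fun F DF hF => ?_⟩
  rw [integral_mul_integral_comm hY h₂ hF.1, ← integral_prod_mul_eq hF.2.1 hU,
    integral_mul_integral_comm (f := fun x (p : ℝ≥0 × Ω) => u p.1 x p.2) hu' h₁ hF.2.1]
  refine integral_congr_ae ?_
  filter_upwards [h] with x hx
  exact (hx.2.2 F DF hF).trans (integral_prod_mul_eq hF.2.1 hx.1).symm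

/-- The Skorohod integrals of a measurable field have a jointly measurable version. -/
theorem exists_measurable_skorohodIntegral [IsProbabilityMeasure P] (hB : IsBrownianReal B P)
    (hBm : ∀ t, Measurable (B t)) (hgen : GeneratedBy B P) {Y : X → Ω → ℝ}
    (hu : Measurable fun p : ℝ≥0 × X × Ω => u p.1 p.2.1 p.2.2)
    (h : ∀ x, IsSkorohodIntegral B P (fun t ω => u t x ω) (Y x)) :
    ∃ Z : X → Ω → ℝ, Measurable (fun p : X × Ω => Z p.1 p.2) ∧ ∀ x, Z x =ᵐ[P] Y x := by
  have hsep := separableSpace_Lp_two hB hBm hgen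
  let v (x : X) : Lp ℝ 2 P := (h x).2.1.toLp (Y x)
  have hinner (w : Lp ℝ 2 P) : Measurable fun x => inner ℝ w (v x) := by
    refine measurable_inner_of_mem_closure_span (S := Set.range fun q : ℝ × (ℝ≥0 →₀ ℝ) =>
      (memLp_trigRV (P := P) hBm q.1 q.2).toLp _) ?_
      (by rw [topologicalClosure_span_trigRV hBm hgen]; trivial)
    rintro _ ⟨⟨b, c⟩, rfl⟩
    -- Duality replaces the arbitrarily chosen `Y x` by an integral of `u`, whose dependence on `x`
    -- is measurable.
    have heq (x : X) : inner ℝ ((memLp_trigRV (P := P) hBm b c).toLp _) (v x) =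
        ∫ ω, ∫ t, trigDeriv B b c t ω * u t x ω ∂lebesgue ∂P := by
      rw [← (h x).2.2 _ _ (isMalliavinDeriv_trigRV hB.toIsPreBrownianReal hBm b c), L2.inner_def]
      refine integral_congr_ae ?_
      filter_upwards [(memLp_trigRV (P := P) hBm b c).coeFn_toLp, (h x).2.1.coeFn_toLp]
        with ω h1 h2
      simp [v, h1, h2, mul_comm]
    simp only [heq]
    have hm : Measurable fun p : (X × Ω) × ℝ≥0 =>
        trigDeriv B b c p.2 p.1.2 * u p.2 p.1.1 p.1.2 :=
      ((measurable_trigDeriv hBm b c).comp (measurable_snd.prodMk measurable_fst.snd)).mul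
        (hu.comp (measurable_snd.prodMk measurable_fst))
    exact hm.stronglyMeasurable.integral_prod_right'.integral_prod_right'.measurable
  have hnorm (d : Lp ℝ 2 P) : Measurable fun x => ‖v x - d‖ :=
    measurable_norm_of_measurable_inner fun w => by
      simpa only [inner_sub_right] using (hinner w).sub_const _
  obtain ⟨Z, hZ, hZv⟩ := exists_measurable_version hnorm
  exact ⟨Z, hZ, fun x => (hZv x).trans (h x).2.1.coeFn_toLp⟩

end Fubini

end SkorohodCalculus

theorem mainTheorem7 {Ω : Type*} [MeasurableSpace Ω] (P : Measure Ω) [IsProbabilityMeasure P]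
    (B : ℝ≥0 → Ω → ℝ) (hB : IsBrownianReal B P) (hBmeas : ∀ t, Measurable (B t))
    (hgen : SkorohodCalculus.GeneratedBy B P)
    (G : Set ℝ) (μ : Measure G) [SigmaFinite μ]
    (u : ℝ≥0 → G → Ω → ℝ)
    (hu : Measurable fun p : ℝ≥0 × G × Ω => u p.1 p.2.1 p.2.2)
    (hdom : ∀ x : G, SkorohodCalculus.SkorohodIntegrable B P (fun t ω => u t x ω))
    (h₁ : ∫⁻ x : G, (∫⁻ ω, ∫⁻ t, ‖u t x ω‖ₑ ^ 2 ∂SkorohodCalculus.lebesgue ∂P) ^ (1 / 2 : ℝ) ∂μ < ∞)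
    (h₂ : ∫⁻ x : G, (∫⁻ ω, ‖SkorohodCalculus.skorohod B P (fun t ω' => u t x ω') ω‖ₑ ^ 2 ∂P)
      ^ (1 / 2 : ℝ) ∂μ < ∞) :
    -- the pathwise integral `∫ uₜ(x) dμ(x)` converges absolutely
    (∀ᵐ p : ℝ≥0 × Ω ∂(SkorohodCalculus.lebesgue.prod P), Integrable (fun x : G => u p.1 x p.2) μ) ∧
    SkorohodCalculus.SkorohodIntegrable B P (fun t ω => ∫ x : G, u t x ω ∂μ) ∧
    -- `(x, ω) ↦ δ(u(x))(ω)` has a jointly measurable version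
    (∃ Y : G → Ω → ℝ, Measurable (fun p : G × Ω => Y p.1 p.2) ∧
      ∀ x : G, Y x =ᵐ[P] SkorohodCalculus.skorohod B P (fun t ω => u t x ω)) ∧
    -- and every such version satisfies the Fubini identity
    ∀ Y : G → Ω → ℝ, Measurable (fun p : G × Ω => Y p.1 p.2) →
      (∀ᵐ x : G ∂μ, Y x =ᵐ[P] SkorohodCalculus.skorohod B P (fun t ω => u t x ω)) →
      (∀ᵐ ω ∂P, Integrable (fun x : G => Y x ω) μ) ∧
      SkorohodCalculus.skorohod B P (fun t ω => ∫ x : G, u t x ω ∂μ)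
        =ᵐ[P] fun ω => ∫ x : G, Y x ω ∂μ := by
  have hu' := SkorohodCalculus.measurable_swap_field hu
  have h₁' : ∫⁻ x : G, (∫⁻ p : ℝ≥0 × Ω, ‖u p.1 x p.2‖ₑ ^ 2 ∂SkorohodCalculus.lebesgue.prod P) ^
      (1 / 2 : ℝ) ∂μ < ∞ := by
    refine lt_of_eq_of_lt (lintegral_congr fun x => ?_) h₁
    rw [lintegral_prod_symm']
    exact (hu'.comp measurable_prodMk_left).enorm.pow_const 2
  have hversion := SkorohodCalculus.exists_measurable_skorohodIntegral hB hBmeas hgen hu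
    fun x => (hdom x).isSkorohodIntegral
  have h₂' (Y : G → Ω → ℝ)
      (hY : ∀ᵐ x : G ∂μ, Y x =ᵐ[P] SkorohodCalculus.skorohod B P (fun t ω => u t x ω)) :
      ∫⁻ x : G, (∫⁻ ω, ‖Y x ω‖ₑ ^ 2 ∂P) ^ (1 / 2 : ℝ) ∂μ < ∞ := by
    refine lt_of_eq_of_lt (lintegral_congr_ae ?_) h₂
    filter_upwards [hY] with x hx
    congr 1
    refine lintegral_congr_ae ?_
    filter_upwards [hx] with ω hω
    rw [hω]
  have hfub (Y : G → Ω → ℝ) (hYm : Measurable (fun p : G × Ω => Y p.1 p.2))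
      (hY : ∀ᵐ x : G ∂μ, Y x =ᵐ[P] SkorohodCalculus.skorohod B P (fun t ω => u t x ω)) :
      SkorohodCalculus.IsSkorohodIntegral B P (fun t ω => ∫ x : G, u t x ω ∂μ)
        fun ω => ∫ x : G, Y x ω ∂μ := by
    refine SkorohodCalculus.isSkorohodIntegral_integral hu hYm h₁' (h₂' Y hY) ?_
    filter_upwards [hY] with x hx using (hdom x).isSkorohodIntegral.congr hx
  have hint : SkorohodCalculus.SkorohodIntegrable B P (fun t ω => ∫ x : G, u t x ω ∂μ) := by
    obtain ⟨Y, hYm, hY⟩ := hversion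
    exact ⟨_, hfub Y hYm (Eventually.of_forall hY)⟩
  refine ⟨SkorohodCalculus.ae_integrable_of_lintegral_sqrt_lt_top
    (f := fun x (p : ℝ≥0 × Ω) => u p.1 x p.2) hu' h₁', hint, hversion, fun Y hYm hY => ⟨?_, ?_⟩⟩
  · exact SkorohodCalculus.ae_integrable_of_lintegral_sqrt_lt_top hYm (h₂' Y hY)
  -- `skorohod` is an arbitrary choice of version, so the identity follows from uniqueness.
  · exact hint.isSkorohodIntegral.ae_eq hB.toIsPreBrownianReal hBmeas hgen (hfub Y hYm hY)
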